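/- Theorem 2.1 ("Sufficient condition for extremality"). Let $G=(V,E)$ be a connected, vertex-transitive, locally finite simple graph. For a finite set $\gamma\subset V$ let $\partial\gamma$ be the set of edges with exactly one endpoint in $\gamma$, and let $$\mathrm{IC}_G=\inf\Big\{\frac{|\partial\gamma|}{|\gamma|} : \gamma\subset V \text{ finite and non-empty}\Big\}$$ be the isoperimetric constant of $G$. For $\beta>0$, a finite set $\Lambda\subset V$ and $\omega\in\{-1,+1\}^V$, let $\mu_\Lambda^\omega$ (depending on $\beta$) be the Ising measure in $\Lambda$ with boundary condition $\omega$, that is, the probability measure on $\{-1,+1\}^\Lambda$ proportional to $\exp(-\beta H_\Lambda^\omega(\sigma))$, where $$H_\Lambda^\omega(\sigma)=-\sum_{\{i,j\}\in E,\; i,j\in\Lambda}\sigma_i\sigma_j-\sum_{\{i,j\}\in E,\; i\in\Lambda,\, j\notin\Lambda}\sigma_i\omega_j ,$$ regarded as a measure on $\{-1,+1\}^V$ carried by the configurations equal to $\omega$ off $\Lambda$. Let $\mathcal G_\beta$ be the convex set of probability measures $\mu$ on $\{-1,+1\}^V$ such that $\mu=\int\mu_\Lambda^\omega\,d\mu(\omega)$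 for every finite $\Lambda\subset V$. Let $\delta_{\max}\ge 0$ be an integer with $\delta_{\max}<\tfrac12\,\mathrm{IC}_G$. Then there is $\beta_0>0$ (depending only on $G$ and $\delta_{\max}$) such that for every $\beta>\beta_0$ and every $\omega\in\{-1,+1\}^V$ such that each vertex $i\in V$ has at most $\delta_{\max}$ neighbours $j$ with $\omega_i\neq\omega_j$, the following holds: there is exactly one probability measure $\mu^\omega$ on $\{-1,+1\}^V$ such that $\mu_\Lambda^\omega\to\mu^\omega$ weakly as $\Lambda\uparrow V$ along the directed set of finite subsets of $V$; moreover $\mu^\omega\in\mathcal G_\beta$, and $\mu^\omega$ is an extreme point of $\mathcal G_\beta$. -/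

import Mathlib

namespace Ising

open MeasureTheory Filter Topology
open scoped NNReal ENNReal BoundedContinuousFunction

/-- The single-spin space `{-1, +1}`, with its discrete topology and discrete σ-algebra. Spin
configurations on `V` are functions `V → Spin`, with the product topology and the product
σ-algebra. -/
abbrev Spin : Type := ({-1, 1} : Set ℤ)

/-- The real value `-1` or `+1` of a spin. -/
def spinVal (s : Spin) : ℝ := ((s : ℤ) : ℝ)

section Graph

variable {V : Type*} (G : SimpleGraph V)

/-- `G` is (vertex-)transitive: its automorphism group acts transitively on the vertices. -/
def IsTransitive : Prop := ∀ u v : V, ∃ φ : G ≃g G, φ u = v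

/-- `ω` is a `δ`-inhomogeneous configuration: at most `δ` frustrated edges (edges whose endpoints
carry different spins) emanate from any vertex. -/
def IsInhomogeneous (δ : ℕ) (ω : V → Spin) : Prop :=
  ∀ i : V, {j : V | G.Adj i j ∧ ω i ≠ ω j}.encard ≤ δ

variable [G.LocallyFinite]

open Classical in
/-- The edges emanating from the finite vertex set `Λ`; each of them appears exactly once, as the
pair `(v, w)` of its endpoint `v ∈ Λ` and its endpoint `w ∉ Λ`. -/
noncomputable def edgeBoundary (Λ : Finset V) : Finset (V × V) :=
  (Λ ×ˢ Λ.biUnion fun v => G.neighborFinset v).filter fun p => G.Adj p.1 p.2 ∧ p.2 ∉ Λ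

open Classical in
/-- The edges of `G` with both endpoints in `Λ`. -/
noncomputable def innerEdges (Λ : Finset V) : Finset (Sym2 V) :=
  Λ.sym2.filter fun e => e ∈ G.edgeSet

/-- The (edge-)isoperimetric constant: the infimum of `|∂γ| / |γ|` over the finite non-empty sets
`γ` of vertices. -/
noncomputable def isoperimetricConstant : ℝ :=
  ⨅ γ : {γ : Finset V // γ.Nonempty}, ((edgeBoundary G γ.1).card : ℝ) / (γ.1.card : ℝ)

open Classical in
/-- The configuration that equals `σ` on `Λ` and `ω` off `Λ`. -/
noncomputable def glue (Λ : Finset V) (σ : Λ → Spin) (ω : V → Spin) : V → Spin :=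
  fun i => if h : i ∈ Λ then σ ⟨i, h⟩ else ω i

/-- The Ising Hamiltonian in `Λ` with boundary condition `ω`. -/
noncomputable def hamiltonian (Λ : Finset V) (ω : V → Spin) (σ : Λ → Spin) : ℝ :=
  - (∑ e ∈ innerEdges G Λ, (e.map fun i => spinVal (glue Λ σ ω i)).mul)
  - ∑ p ∈ edgeBoundary G Λ, spinVal (glue Λ σ ω p.1) * spinVal (ω p.2)

open Classical in
/-- The partition function in `Λ` with boundary condition `ω`, at inverse temperature `β`. -/
noncomputable def partitionFunction (β : ℝ) (Λ : Finset V) (ω : V → Spin) : ℝ :=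
  ∑ σ : Λ → Spin, Real.exp (-β * hamiltonian G Λ ω σ)

open Classical in
/-- The Ising model in `Λ` with boundary condition `ω`, at inverse temperature `β`: the
probability measure with weights proportional to `exp (-β H)`, regarded as a measure on `V → Spin`
carried by the configurations that equal `ω` off `Λ`. -/
noncomputable def finiteVolumeMeasure (β : ℝ) (Λ : Finset V) (ω : V → Spin) :
    Measure (V → Spin) :=
  ∑ σ : Λ → Spin,
    ENNReal.ofReal (Real.exp (-β * hamiltonian G Λ ω σ) / partitionFunction G β Λ ω) •
      Measure.dirac (glue Λ σ ω)

/-- The infinite-volume Gibbs measures at inverse temperature `β`: the probability measures that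
satisfy the DLR equations `μ = ∫ μ(dω) μ_Λ^ω` for all finite `Λ`. -/
def gibbsMeasures (β : ℝ) : Set (Measure (V → Spin)) :=
  {μ | IsProbabilityMeasure μ ∧ ∀ (Λ : Finset V) (A : Set (V → Spin)), MeasurableSet A →
    μ A = ∫⁻ ω, finiteVolumeMeasure G β Λ ω A ∂μ}

/-- The probability measure `μ` is the weak limit of the finite-volume Ising measures with boundary
condition `ω`, as the finite set `Λ` increases to `V` (along the directed set of all finite
subsets of `V`). -/
def IsWeakLimit (β : ℝ) (ω : V → Spin) (μ : Measure (V → Spin)) : Prop :=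
  IsProbabilityMeasure μ ∧ ∀ f : (V → Spin) →ᵇ ℝ,
    Tendsto (fun Λ : Finset V => ∫ σ, f σ ∂(finiteVolumeMeasure G β Λ ω)) atTop
      (𝓝 (∫ σ, f σ ∂μ))

end Graph

end Ising

namespace Ising

open MeasureTheory Filter Topology
open scoped NNReal ENNReal BoundedContinuousFunction Classical

/-! Put $c=\mathrm{IC}_G-2\delta_{\max}>0$. Flipping a finite set $\gamma$ in $\omega$ costs energy
at least $2c|\gamma|$: of the boundary edges of $\gamma$, at most $\delta_{\max}|\gamma|$ are
frustrated (`boundarySum_ge`). So $\omega$ is a rigid ground state, and at large $\beta$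
discrepancies from it are rare.

Two measures are compared through independent copies. Let $C$ be the union of the components, in the
set where either copy differs from $\omega$, that meet a finite set $A$. Given $C=\gamma$, both
copies equal $\omega$ on the part of $A$ and of the surroundings of $\gamma$ outside $\gamma$, so
they can be exchanged inside $\gamma$ (`prod_clusterEvent_swap`). Hence two measures satisfying the
DLR equations in $\Lambda$ differ on events in $A$ by at most the probability that $C$ leaves
$\Lambda$ (`measure_cyl_le_add`).

For finite volumes $P(C=\gamma)$ is at most $(4e^{-2\beta c})^{|\gamma|}$. These bounds are summable
over $\gamma$, uniformly in the volumes (`prod_clusterEvent_le`, `tsum_clusterWeight_le`). Cylinder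
probabilities are therefore Cauchy, and compactness supplies the limit $\mu$. Its flip ratios pass
to the limit, so it is Gibbs.

For extremality, $C$ is almost surely finite under $\mu\otimes\mu$. A Gibbs component $\nu$ of $\mu$
satisfies $\nu\ll\mu$, so $C$ is also almost surely finite under $\nu\otimes\mu$, and the comparison
gives $\nu=\mu$ (`eq_of_absolutelyContinuous`). -/

/-- The opposite spin. -/
def Spin.flip (s : Spin) : Spin :=
  ⟨-s, by rcases s with ⟨s, rfl | rfl⟩ <;> simp⟩

@[simp] lemma spinVal_flip (s : Spin) : spinVal s.flip = -spinVal s := by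
  simp [spinVal, Spin.flip]

@[simp] lemma Spin.flip_flip (s : Spin) : s.flip.flip = s := by
  simp [Spin.flip]

lemma Spin.flip_ne (s : Spin) : s.flip ≠ s := by
  rcases s with ⟨s, rfl | rfl⟩ <;> simp [Spin.flip, Subtype.ext_iff]

lemma Spin.eq_flip_of_ne {s t : Spin} (h : s ≠ t) : s = t.flip := by
  rcases s with ⟨s, rfl | rfl⟩ <;> rcases t with ⟨t, rfl | rfl⟩ <;> simp_all [Spin.flip]

lemma spinVal_mul_of_eq {s t : Spin} (h : s = t) : spinVal s * spinVal t = 1 := by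
  subst h
  rcases s with ⟨s, rfl | rfl⟩ <;> simp [spinVal]

lemma spinVal_mul_of_ne {s t : Spin} (h : s ≠ t) : spinVal s * spinVal t = -1 := by
  rw [Spin.eq_flip_of_ne h, spinVal_flip, neg_mul, spinVal_mul_of_eq rfl]

/-! ### Flipping a finite set of spins and its energy cost -/

section Combinatorics

variable {V : Type*}

/-- The configuration obtained from `τ` by flipping all spins in `γ`. -/
noncomputable def flipOn (γ : Finset V) (τ : V → Spin) : V → Spin :=
  fun i => if i ∈ γ then (τ i).flip else τ i

lemma flipOn_ne_iff {γ : Finset V} {τ : V → Spin} {i : V} : flipOn γ τ i ≠ τ i ↔ i ∈ γ := by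
  by_cases h : i ∈ γ <;> simp [flipOn, h, Spin.flip_ne]

/-- The set of configurations that agree with `τ` on `F`. -/
def cyl (F : Finset V) (τ : V → Spin) : Set (V → Spin) := {σ | ∀ i ∈ F, σ i = τ i}

lemma mem_cyl {F : Finset V} {τ σ : V → Spin} : σ ∈ cyl F τ ↔ ∀ i ∈ F, σ i = τ i := Iff.rfl

variable (G : SimpleGraph V) [G.LocallyFinite]

lemma mem_edgeBoundary {Λ : Finset V} {p : V × V} :
    p ∈ edgeBoundary G Λ ↔ p.1 ∈ Λ ∧ G.Adj p.1 p.2 ∧ p.2 ∉ Λ := by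
  simp only [edgeBoundary, Finset.mem_filter, Finset.mem_product, Finset.mem_biUnion,
    SimpleGraph.mem_neighborFinset]
  constructor
  · rintro ⟨⟨h, -⟩, h2⟩; exact ⟨h, h2⟩
  · rintro ⟨h, h2⟩; exact ⟨⟨h, p.1, h, h2.1⟩, h2⟩

/-- The set `γ` together with all neighbours of its elements. -/
noncomputable def nbhd (γ : Finset V) : Finset V := γ ∪ γ.biUnion fun v => G.neighborFinset v

lemma subset_nbhd (γ : Finset V) : γ ⊆ nbhd G γ := Finset.subset_union_left

lemma mem_nbhd_of_adj {γ : Finset V} {i j : V} (hi : i ∈ γ) (h : G.Adj i j) : j ∈ nbhd G γ := by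
  simp only [nbhd, Finset.mem_union, Finset.mem_biUnion, SimpleGraph.mem_neighborFinset]
  exact Or.inr ⟨i, hi, h⟩

lemma nbhd_mono {γ γ' : Finset V} (h : γ ⊆ γ') : nbhd G γ ⊆ nbhd G γ' :=
  Finset.union_subset_union h (Finset.biUnion_subset_biUnion_of_subset_left _ h)

/-- The sum of the products of the two spins over the edges in the boundary of `γ`. -/
noncomputable def boundarySum (γ : Finset V) (τ : V → Spin) : ℝ :=
  ∑ p ∈ edgeBoundary G γ, spinVal (τ p.1) * spinVal (τ p.2)

lemma boundarySum_congr {γ F : Finset V} (hF : nbhd G γ ⊆ F) {σ τ : V → Spin}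
    (h : σ ∈ cyl F τ) : boundarySum G γ σ = boundarySum G γ τ := by
  refine Finset.sum_congr rfl fun p hp => ?_
  obtain ⟨h1, h2, -⟩ := (mem_edgeBoundary G).1 hp
  rw [h _ (hF (subset_nbhd G γ h1)), h _ (hF (mem_nbhd_of_adj G h1 h2))]

lemma glue_of_mem {Λ : Finset V} (σ : Λ → Spin) (ω : V → Spin) {i : V} (h : i ∈ Λ) :
    glue Λ σ ω i = σ ⟨i, h⟩ := by simp [glue, h]

lemma glue_of_notMem {Λ : Finset V} (σ : Λ → Spin) (ω : V → Spin) {i : V} (h : i ∉ Λ) :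
    glue Λ σ ω i = ω i := by simp [glue, h]

/-- Flipping the spins of `γ` in a configuration on `Λ`. -/
noncomputable def flipIn (Λ γ : Finset V) (σ : Λ → Spin) : Λ → Spin :=
  fun i => if (i : V) ∈ γ then (σ i).flip else σ i

lemma flipIn_flipIn (Λ γ : Finset V) (σ : Λ → Spin) : flipIn Λ γ (flipIn Λ γ σ) = σ := by
  funext i; by_cases h : (i : V) ∈ γ <;> simp [flipIn, h]

lemma glue_flipIn {Λ γ : Finset V} (h : γ ⊆ Λ) (σ : Λ → Spin) (ω : V → Spin) :
    glue Λ (flipIn Λ γ σ) ω = flipOn γ (glue Λ σ ω) := by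
  funext i
  by_cases hi : i ∈ Λ
  · simp [glue, flipIn, flipOn, hi]
  · have : i ∉ γ := fun h' => hi (h h')
    simp [glue, flipOn, hi, this]

/-- Only edges with exactly one end in `γ` change sign. Orienting each from its end in `γ` matches
them with boundary pairs of `γ` whose outer end is in `Λ`. -/
lemma sum_innerEdges_flipOn {Λ γ : Finset V} (h : γ ⊆ Λ) (τ : V → Spin) :
    ∑ e ∈ innerEdges G Λ, (e.map fun i => spinVal (flipOn γ τ i)).mul =
      ∑ e ∈ innerEdges G Λ, (e.map fun i => spinVal (τ i)).mul
        - 2 * ∑ p ∈ edgeBoundary G γ with p.2 ∈ Λ, spinVal (τ p.1) * spinVal (τ p.2) := by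
  have key : ∑ p ∈ edgeBoundary G γ with p.2 ∈ Λ, spinVal (τ p.1) * spinVal (τ p.2) =
      ∑ e ∈ innerEdges G Λ with (∃ i ∈ e, i ∈ γ) ∧ ∃ i ∈ e, i ∉ γ,
        (e.map fun i => spinVal (τ i)).mul := by
    refine Finset.sum_bij (fun p _ => s(p.1, p.2)) ?_ ?_ ?_ ?_
    · rintro ⟨a, b⟩ hp
      simp only [Finset.mem_filter, mem_edgeBoundary] at hp
      simp only [innerEdges, Finset.mem_filter, Finset.mk_mem_sym2_iff, SimpleGraph.mem_edgeSet]
      exact ⟨⟨⟨h hp.1.1, hp.2⟩, hp.1.2.1⟩, ⟨a, by simp, hp.1.1⟩, ⟨b, by simp, hp.1.2.2⟩⟩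
    · rintro ⟨a, b⟩ hp ⟨a', b'⟩ hp' heq
      simp only [Finset.mem_filter, mem_edgeBoundary] at hp hp'
      simp only [Sym2.eq_iff] at heq
      rcases heq with ⟨rfl, rfl⟩ | ⟨rfl, rfl⟩
      · rfl
      · exact absurd hp.1.1 hp'.1.2.2
    · intro e he
      induction e with | _ a b =>
      simp only [innerEdges, Finset.mem_filter, Finset.mk_mem_sym2_iff, SimpleGraph.mem_edgeSet,
        Sym2.mem_iff, exists_eq_or_imp, exists_eq_left] at he
      obtain ⟨⟨⟨ha, hb⟩, hab⟩, h1, h2⟩ := he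
      by_cases haγ : a ∈ γ
      · have hbγ : b ∉ γ := by tauto
        exact ⟨(a, b), by simp [mem_edgeBoundary, *], rfl⟩
      · have hbγ : b ∈ γ := by tauto
        exact ⟨(b, a), by simp [mem_edgeBoundary, hab.symm, *], Sym2.eq_swap⟩
    · rintro ⟨a, b⟩ hp
      simp
  rw [key, Finset.sum_filter, Finset.mul_sum, ← Finset.sum_sub_distrib]
  refine Finset.sum_congr rfl fun e _ => ?_
  induction e with | _ a b =>
  by_cases ha : a ∈ γ <;> by_cases hb : b ∈ γ <;> simp [flipOn, ha, hb] <;> ring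

/-- Boundary edges of `γ` that stay in `Λ` act on the inner sum, those that leave `Λ` on the
boundary term; both kinds change sign. -/
lemma hamiltonian_flipIn {Λ γ : Finset V} (h : γ ⊆ Λ) (σ : Λ → Spin) (ω : V → Spin) :
    hamiltonian G Λ ω (flipIn Λ γ σ) =
      hamiltonian G Λ ω σ + 2 * boundarySum G γ (glue Λ σ ω) := by
  unfold hamiltonian
  rw [glue_flipIn h, sum_innerEdges_flipOn G h]
  set τ := glue Λ σ ω with hτ
  have hb : boundarySum G γ τ =
      ∑ p ∈ edgeBoundary G γ with p.2 ∈ Λ, spinVal (τ p.1) * spinVal (τ p.2) +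
      ∑ p ∈ edgeBoundary G γ with p.2 ∉ Λ, spinVal (τ p.1) * spinVal (τ p.2) :=
    (Finset.sum_filter_add_sum_filter_not _ _ _).symm
  have he : (edgeBoundary G γ).filter (fun p => p.2 ∉ Λ) =
      (edgeBoundary G Λ).filter fun p => p.1 ∈ γ := by
    ext p
    simp only [Finset.mem_filter, mem_edgeBoundary]
    constructor
    · rintro ⟨⟨h1, h2, h3⟩, h4⟩; exact ⟨⟨h h1, h2, h4⟩, h1⟩
    · rintro ⟨⟨h1, h2, h3⟩, h4⟩; exact ⟨⟨h4, h2, fun h' => h3 (h h')⟩, h3⟩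
  have hs : ∑ p ∈ edgeBoundary G Λ, spinVal (flipOn γ τ p.1) * spinVal (ω p.2) =
      ∑ p ∈ edgeBoundary G Λ, spinVal (τ p.1) * spinVal (ω p.2)
        - 2 * ∑ p ∈ edgeBoundary G Λ with p.1 ∈ γ, spinVal (τ p.1) * spinVal (τ p.2) := by
    rw [Finset.sum_filter, Finset.mul_sum, ← Finset.sum_sub_distrib]
    refine Finset.sum_congr rfl fun p hp => ?_
    have : τ p.2 = ω p.2 := glue_of_notMem _ _ ((mem_edgeBoundary G).1 hp).2.2
    by_cases h1 : p.1 ∈ γ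
    · simp only [flipOn, h1, if_true, spinVal_flip, this]
      ring
    · simp [flipOn, h1]
  rw [hb, he, hs]
  ring

end Combinatorics

/-! ### The DLR equations as ratios of cylinder probabilities -/

section Specification

variable {V : Type*}

lemma measurableSet_cyl (F : Finset V) (τ : V → Spin) : MeasurableSet (cyl F τ) := by
  have : cyl F τ = ⋂ i ∈ F, (fun σ : V → Spin => σ i) ⁻¹' {τ i} := by
    ext; simp [cyl]
  rw [this]
  exact Finset.measurableSet_biInter _ fun i _ => measurable_pi_apply i (measurableSet_singleton _)

lemma isClopen_cyl (F : Finset V) (τ : V → Spin) : IsClopen (cyl F τ) := by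
  have : cyl F τ = ⋂ i ∈ F, (fun σ : V → Spin => σ i) ⁻¹' {τ i} := by
    ext; simp [cyl]
  rw [this]
  exact isClopen_biInter_finset fun i _ => (isClopen_discrete _).preimage (continuous_apply i)

lemma cyl_congr {F : Finset V} {σ τ : V → Spin} (h : σ ∈ cyl F τ) : cyl F σ = cyl F τ := by
  ext η
  exact ⟨fun hη i hi => (hη i hi).trans (h i hi), fun hη i hi => (hη i hi).trans (h i hi).symm⟩

lemma cyl_anti {F F' : Finset V} (h : F ⊆ F') (τ : V → Spin) : cyl F' τ ⊆ cyl F τ :=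
  fun _ hσ i hi => hσ i (h hi)

lemma flipOn_mem_cyl {F γ : Finset V} {σ τ : V → Spin} :
    flipOn γ σ ∈ cyl F τ ↔ σ ∈ cyl F (flipOn γ τ) := by
  refine forall₂_congr fun i _ => ?_
  by_cases h : i ∈ γ
  · simp only [flipOn, h, if_true]
    exact ⟨fun h => by rw [← h, Spin.flip_flip], fun h => by rw [h, Spin.flip_flip]⟩
  · simp [flipOn, h]

variable (G : SimpleGraph V) [G.LocallyFinite]

/-- The ratio of the Boltzmann weights of `flipOn γ τ` and `τ`. -/
noncomputable def flipWeight (β : ℝ) (γ : Finset V) (τ : V → Spin) : ℝ≥0∞ :=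
  ENNReal.ofReal (Real.exp (-2 * β * boundarySum G γ τ))

lemma flipWeight_ne_zero (β : ℝ) (γ : Finset V) (τ : V → Spin) : flipWeight G β γ τ ≠ 0 := by
  simp [flipWeight, Real.exp_pos]

lemma flipWeight_ne_top (β : ℝ) (γ : Finset V) (τ : V → Spin) : flipWeight G β γ τ ≠ ∞ :=
  ENNReal.ofReal_ne_top

lemma partitionFunction_pos (β : ℝ) (Λ : Finset V) (ω : V → Spin) :
    0 < partitionFunction G β Λ ω :=
  Finset.sum_pos (fun _ _ => Real.exp_pos _) ⟨fun i => ω i, Finset.mem_univ _⟩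

lemma finiteVolumeMeasure_apply (β : ℝ) (Λ : Finset V) (ω : V → Spin) {A : Set (V → Spin)}
    (hA : MeasurableSet A) :
    finiteVolumeMeasure G β Λ ω A = ∑ σ : Λ → Spin,
      ENNReal.ofReal (Real.exp (-β * hamiltonian G Λ ω σ) / partitionFunction G β Λ ω) *
        A.indicator 1 (glue Λ σ ω) := by
  simp [finiteVolumeMeasure, Measure.dirac_apply' _ hA]

instance isProbabilityMeasure_finiteVolumeMeasure (β : ℝ) (Λ : Finset V) (ω : V → Spin) :
    IsProbabilityMeasure (finiteVolumeMeasure G β Λ ω) := by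
  constructor
  rw [finiteVolumeMeasure_apply G β Λ ω MeasurableSet.univ]
  have hZ := partitionFunction_pos G β Λ ω
  simp only [Set.indicator_univ, Pi.one_apply, mul_one]
  rw [← ENNReal.ofReal_sum_of_nonneg fun _ _ => by positivity, ← Finset.sum_div]
  change ENNReal.ofReal (partitionFunction G β Λ ω / _) = 1
  rw [div_self hZ.ne', ENNReal.ofReal_one]

lemma finiteVolumeMeasure_cyl_of_disjoint (β : ℝ) {Λ F : Finset V} (h : Disjoint F Λ)
    (ω τ : V → Spin) :
    finiteVolumeMeasure G β Λ ω (cyl F τ) = (cyl F τ).indicator 1 ω := by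
  have hg : ∀ σ : Λ → Spin, (cyl F τ).indicator (1 : (V → Spin) → ℝ≥0∞) (glue Λ σ ω) =
      (cyl F τ).indicator 1 ω := by
    intro σ
    have : glue Λ σ ω ∈ cyl F τ ↔ ω ∈ cyl F τ := by
      refine forall₂_congr fun i hi => ?_
      rw [glue_of_notMem _ _ (Finset.disjoint_left.1 h hi)]
    simp [Set.indicator, this]
  have h1 := measure_univ (μ := finiteVolumeMeasure G β Λ ω)
  rw [finiteVolumeMeasure_apply G β Λ ω MeasurableSet.univ] at h1
  simp only [Set.indicator_univ, Pi.one_apply, mul_one] at h1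
  rw [finiteVolumeMeasure_apply G β Λ ω (measurableSet_cyl F τ)]
  simp_rw [hg]
  rw [← Finset.sum_mul, h1, one_mul]

lemma boundarySum_flipOn (γ : Finset V) (τ : V → Spin) :
    boundarySum G γ (flipOn γ τ) = -boundarySum G γ τ := by
  rw [boundarySum, boundarySum, ← Finset.sum_neg_distrib]
  refine Finset.sum_congr rfl fun p hp => ?_
  obtain ⟨h1, -, h2⟩ := (mem_edgeBoundary G).1 hp
  simp [flipOn, h1, h2]

/-- The measure `ν` satisfies the DLR equations for the flips inside `U`: the probabilities of
two cylinder events that differ by a flip of `γ ⊆ U` have the ratio of the Boltzmann weights. -/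
def FlipRatio (β : ℝ) (ν : Measure (V → Spin)) (U : Set V) : Prop :=
  ∀ γ : Finset V, ↑γ ⊆ U → ∀ F : Finset V, nbhd G γ ⊆ F → ∀ τ : V → Spin,
    ν (cyl F (flipOn γ τ)) = flipWeight G β γ τ * ν (cyl F τ)

variable {G} in
lemma FlipRatio.mono {β : ℝ} {ν : Measure (V → Spin)} {U U' : Set V} (h : FlipRatio G β ν U)
    (hU : U' ⊆ U) : FlipRatio G β ν U' :=
  fun γ hγ => h γ (hγ.trans hU)

/-- Flipping `γ` is an involution that exchanges the two cylinders. Since `F` contains the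
neighbourhood of `γ`, the energy change is constant on each of them, and the partition function is
common to both sides. -/
lemma flipRatio_finiteVolumeMeasure (β : ℝ) (Λ : Finset V) (ω : V → Spin) :
    FlipRatio G β (finiteVolumeMeasure G β Λ ω) Λ := by
  intro γ hγ F hF τ
  have hγ : γ ⊆ Λ := by exact_mod_cast hγ
  rw [finiteVolumeMeasure_apply G β Λ ω (measurableSet_cyl _ _),
    finiteVolumeMeasure_apply G β Λ ω (measurableSet_cyl _ _), Finset.mul_sum]
  refine Fintype.sum_equiv (Equiv.mk (flipIn Λ γ) (flipIn Λ γ) (flipIn_flipIn Λ γ)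
    (flipIn_flipIn Λ γ)) _ _ ?_
  intro σ
  rw [Equiv.coe_fn_mk, glue_flipIn hγ, hamiltonian_flipIn G hγ]
  by_cases h : glue Λ σ ω ∈ cyl F (flipOn γ τ)
  · have h' : flipOn γ (glue Λ σ ω) ∈ cyl F τ := flipOn_mem_cyl.2 h
    have hs : boundarySum G γ (glue Λ σ ω) = -boundarySum G γ τ := by
      rw [boundarySum_congr G hF h, boundarySum_flipOn]
    rw [Set.indicator_of_mem h, Set.indicator_of_mem h', Pi.one_apply, Pi.one_apply, mul_one, mul_one,
      flipWeight, ← ENNReal.ofReal_mul (Real.exp_nonneg _), ← mul_div_assoc, ← Real.exp_add, hs]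
    congr 3
    ring
  · have h' : flipOn γ (glue Λ σ ω) ∉ cyl F τ := fun h' => h (flipOn_mem_cyl.1 h')
    rw [Set.indicator_of_notMem h, Set.indicator_of_notMem h', mul_zero, mul_zero, mul_zero]

lemma measurable_spinVal_glue (Λ : Finset V) (σ : Λ → Spin) (i : V) :
    Measurable fun ω : V → Spin => spinVal (glue Λ σ ω i) := by
  by_cases h : i ∈ Λ
  · simp only [glue_of_mem _ _ h]; exact measurable_const
  · simp only [glue_of_notMem _ _ h]
    exact (measurable_of_countable spinVal).comp (measurable_pi_apply i)

lemma measurable_glue (Λ : Finset V) (σ : Λ → Spin) :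
    Measurable fun ω : V → Spin => glue Λ σ ω := by
  refine measurable_pi_lambda _ fun i => ?_
  by_cases h : i ∈ Λ
  · simp only [glue_of_mem _ _ h]; exact measurable_const
  · simp only [glue_of_notMem _ _ h]; exact measurable_pi_apply i

lemma measurable_hamiltonian (Λ : Finset V) (σ : Λ → Spin) :
    Measurable fun ω : V → Spin => hamiltonian G Λ ω σ := by
  unfold hamiltonian
  refine Measurable.sub (Measurable.neg (Finset.measurable_sum _ fun e _ => ?_))
    (Finset.measurable_sum _ fun p _ => ?_)
  · induction e with | _ a b =>
    simp only [Sym2.map_mk, Sym2.mul_mk]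
    exact (measurable_spinVal_glue Λ σ a).mul (measurable_spinVal_glue Λ σ b)
  · exact (measurable_spinVal_glue Λ σ _).mul
      ((measurable_of_countable spinVal).comp (measurable_pi_apply _))

lemma measurable_finiteVolumeMeasure (β : ℝ) (Λ : Finset V) :
    Measurable fun ω : V → Spin => finiteVolumeMeasure G β Λ ω := by
  refine Measure.measurable_of_measurable_coe _ fun A hA => ?_
  simp_rw [finiteVolumeMeasure_apply G β Λ _ hA]
  have hw : ∀ σ : Λ → Spin, Measurable fun ω : V → Spin =>
      Real.exp (-β * hamiltonian G Λ ω σ) := fun σ =>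
    Real.measurable_exp.comp ((measurable_hamiltonian G Λ σ).const_mul _)
  refine Finset.measurable_sum _ fun σ _ => Measurable.mul ?_ ?_
  · exact ((hw σ).div (Finset.measurable_sum _ fun σ _ => hw σ)).ennreal_ofReal
  · exact (measurable_one.indicator hA).comp (measurable_glue Λ σ)

-- Integrate the finite-volume identity in the volume `γ` itself.
variable {G} in
lemma flipRatio_of_mem_gibbsMeasures {β : ℝ} {ν : Measure (V → Spin)}
    (h : ν ∈ gibbsMeasures G β) : FlipRatio G β ν Set.univ := by
  intro γ _ F hF τ
  rw [h.2 γ _ (measurableSet_cyl _ _), h.2 γ _ (measurableSet_cyl _ _),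
    ← lintegral_const_mul' _ _ (flipWeight_ne_top _ _ _ _)]
  exact lintegral_congr fun η => flipRatio_finiteVolumeMeasure G β γ η γ le_rfl F hF τ

/-- Restricting to `F` the configurations that agree with `τ` on `F \ Λ` leaves only the flips
of `τ` inside `Λ`. -/
lemma measure_cyl_sdiff {β : ℝ} {ν : Measure (V → Spin)} {Λ F : Finset V}
    (h : FlipRatio G β ν Λ) (hF : nbhd G Λ ⊆ F) (τ : V → Spin) :
    ν (cyl (F \ Λ) τ) = (∑ γ ∈ Λ.powerset, flipWeight G β γ τ) * ν (cyl F τ) := by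
  have hu : cyl (F \ Λ) τ = ⋃ γ ∈ Λ.powerset, cyl F (flipOn γ τ) := by
    ext σ
    simp only [Set.mem_iUnion, Finset.mem_powerset, exists_prop]
    constructor
    · intro hσ
      refine ⟨Λ.filter fun i => σ i ≠ τ i, Finset.filter_subset _ _, fun i hi => ?_⟩
      by_cases hne : σ i = τ i
      · simp [flipOn, hne]
      · have : i ∈ Λ := by
          by_contra hΛ
          exact hne (hσ i (by simp [hi, hΛ]))
        simp [flipOn, this, Spin.eq_flip_of_ne hne]
    · rintro ⟨γ, hγ, hσ⟩ i hi
      rw [Finset.mem_sdiff] at hi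
      rw [hσ i hi.1, flipOn, if_neg fun h' => hi.2 (hγ h')]
  rw [hu, measure_biUnion_finset _ fun γ _ => measurableSet_cyl _ _, Finset.sum_mul]
  · refine Finset.sum_congr rfl fun γ hγ => ?_
    have hγ := Finset.mem_powerset.1 hγ
    exact h γ (by exact_mod_cast hγ) F ((nbhd_mono G hγ).trans hF) τ
  · intro γ hγ γ' hγ' hne
    refine Set.disjoint_left.2 fun σ hσ hσ' => hne ?_
    have hsub : Λ ⊆ F := (subset_nbhd G Λ).trans hF
    have hγ := Finset.mem_powerset.1 (Finset.mem_coe.1 hγ)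
    have hγ' := Finset.mem_powerset.1 (Finset.mem_coe.1 hγ')
    ext i
    by_cases hi : i ∈ Λ
    · rw [← flipOn_ne_iff (τ := τ), ← flipOn_ne_iff (τ := τ), ← hσ i (hsub hi), hσ' i (hsub hi)]
    · exact ⟨fun h => absurd (hγ h) hi, fun h => absurd (hγ' h) hi⟩

/-- The cylinder events on finite sets containing `F₀` determine a probability measure. -/
lemma ext_of_cyl {ν μ : Measure (V → Spin)} [IsProbabilityMeasure ν] [IsProbabilityMeasure μ]
    (F₀ : Finset V) (h : ∀ F, F₀ ⊆ F → ∀ τ, ν (cyl F τ) = μ (cyl F τ)) : ν = μ := by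
  refine ext_of_generate_finite {A | ∃ F, F₀ ⊆ F ∧ ((∃ τ, A = cyl F τ) ∨ A = ∅)} ?_ ?_ ?_ (by simp)
  · refine le_antisymm ?_ ?_
    · refine iSup_le fun i => ?_
      rintro _ ⟨B, hB, rfl⟩
      -- Only cylinders over sets containing `F₀` are generators, so a one-site event is split over
      -- all patterns on `insert i F₀`.
      set F := insert i F₀
      have hi : i ∈ F := Finset.mem_insert_self i F₀
      obtain ⟨ω⟩ : Nonempty (V → Spin) := nonempty_of_isProbabilityMeasure ν
      have hB' : (fun σ : V → Spin => σ i) ⁻¹' B =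
          ⋃ ρ : {ρ : F → Spin // ρ ⟨i, hi⟩ ∈ B}, cyl F (glue F ρ.1 ω) := by
        ext σ
        simp only [Set.mem_preimage, Set.mem_iUnion]
        constructor
        · intro hσ
          exact ⟨⟨fun j => σ j, hσ⟩, fun j hj => (glue_of_mem (fun j : F => σ j) ω hj).symm⟩
        · rintro ⟨⟨ρ, hρ⟩, hσ⟩
          rwa [hσ i hi, glue_of_mem _ _ hi]
      rw [hB']
      exact MeasurableSet.iUnion fun ρ => MeasurableSpace.measurableSet_generateFrom
        ⟨F, Finset.subset_insert _ _, Or.inl ⟨_, rfl⟩⟩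
    · refine MeasurableSpace.generateFrom_le ?_
      rintro _ ⟨F, -, ⟨τ, rfl⟩ | rfl⟩
      · exact measurableSet_cyl _ _
      · exact MeasurableSet.empty
  · rintro _ ⟨F, hF, hA⟩ _ ⟨F', hF', hB⟩ hne
    obtain ⟨σ, hσ, hσ'⟩ := hne
    rcases hA with ⟨τ, rfl⟩ | rfl
    · rcases hB with ⟨τ', rfl⟩ | rfl
      · refine ⟨F ∪ F', hF.trans Finset.subset_union_left, Or.inl ⟨σ, ?_⟩⟩
        rw [← cyl_congr hσ, ← cyl_congr hσ']
        ext η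
        simp only [Set.mem_inter_iff, mem_cyl, Finset.mem_union]
        exact ⟨fun h i hi => hi.elim (h.1 i) (h.2 i), fun h => ⟨fun i hi => h i (.inl hi),
          fun i hi => h i (.inr hi)⟩⟩
      · exact hσ'.elim
    · exact hσ.elim
  · rintro _ ⟨F, hF, ⟨τ, rfl⟩ | rfl⟩
    · exact h F hF τ
    · simp

/-- Resampling `ν` in `Λ` gives a measure `κ` with the same law off `Λ` and the same flip ratios
inside. By `measure_cyl_sdiff` these data determine the probabilities of large cylinders, so `κ =
ν`. -/
lemma mem_gibbsMeasures_of_flipRatio {β : ℝ} {ν : Measure (V → Spin)} [IsProbabilityMeasure ν]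
    (h : FlipRatio G β ν Set.univ) : ν ∈ gibbsMeasures G β := by
  refine ⟨inferInstance, fun Λ => ?_⟩
  have hm := measurable_finiteVolumeMeasure G β Λ
  set κ := ν.bind fun ω => finiteVolumeMeasure G β Λ ω with hκ
  have hκa : ∀ A, MeasurableSet A → κ A = ∫⁻ ω, finiteVolumeMeasure G β Λ ω A ∂ν :=
    fun A hA => Measure.bind_apply hA hm.aemeasurable
  have : IsProbabilityMeasure κ := ⟨by rw [hκa _ MeasurableSet.univ]; simp⟩
  have hκR : FlipRatio G β κ Λ := by
    intro γ hγ F hF τ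
    rw [hκa _ (measurableSet_cyl _ _), hκa _ (measurableSet_cyl _ _),
      ← lintegral_const_mul' _ _ (flipWeight_ne_top _ _ _ _)]
    exact lintegral_congr fun η => flipRatio_finiteVolumeMeasure G β Λ η γ hγ F hF τ
  have hνκ : ν = κ := by
    refine ext_of_cyl (nbhd G Λ) fun F hF τ => ?_
    have h1 := measure_cyl_sdiff G (h.mono (Set.subset_univ _)) hF τ
    have h2 := measure_cyl_sdiff G hκR hF τ
    have h3 : κ (cyl (F \ Λ) τ) = ν (cyl (F \ Λ) τ) := by
      rw [hκa _ (measurableSet_cyl _ _)]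
      simp_rw [finiteVolumeMeasure_cyl_of_disjoint G β Finset.sdiff_disjoint]
      exact lintegral_indicator_one (measurableSet_cyl _ _)
    rw [h1, h2] at h3
    refine ((ENNReal.mul_right_inj ?_ ?_).1 h3).symm
    · intro h0
      -- The empty flip alone keeps the common factor nonzero.
      exact flipWeight_ne_zero G β ∅ τ (Finset.sum_eq_zero_iff.1 h0 ∅ (by simp))
    · exact ENNReal.sum_ne_top.2 fun γ _ => flipWeight_ne_top _ _ _ _
  intro A hA
  rw [← hκa A hA, ← hνκ]

end Specification

/-! ### Clusters of a set of sites -/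

section Cluster

variable {V : Type*} (G : SimpleGraph V)

/-- The union of the connected components of `D` (as an induced subgraph) that meet `A`. -/
def cluster (A : Finset V) (D : Set V) : Set V :=
  {j | ∃ i ∈ A, i ∈ D ∧ Relation.ReflTransGen (fun a b => G.Adj a b ∧ b ∈ D) i j}

variable {G} {A : Finset V} {D : Set V}

lemma mem_cluster_of_mem {i : V} (hA : i ∈ A) (hD : i ∈ D) : i ∈ cluster G A D :=
  ⟨i, hA, hD, .refl⟩

lemma mem_cluster_of_adj {i j : V} (hi : i ∈ cluster G A D) (hij : G.Adj i j) (hj : j ∈ D) :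
    j ∈ cluster G A D := by
  obtain ⟨k, hk, hkD, hr⟩ := hi
  exact ⟨k, hk, hkD, hr.tail ⟨hij, hj⟩⟩

/-- The cluster is the smallest subset of `D` that contains `A ∩ D` and is closed under
adjacency in `D`. -/
lemma cluster_subset_of_closed {C : Set V} (hA : ∀ i ∈ A, i ∈ D → i ∈ C)
    (hC : ∀ i ∈ C, ∀ j, G.Adj i j → j ∈ D → j ∈ C) : cluster G A D ⊆ C := by
  rintro j ⟨i, hi, hiD, hr⟩
  induction hr with
  | refl => exact hA i hi hiD
  | tail _ h ih => exact hC _ ih _ h.1 h.2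

lemma cluster_subset : cluster G A D ⊆ D :=
  cluster_subset_of_closed (fun _ _ h => h) fun _ _ _ _ h => h

lemma cluster_mono {D' : Set V} (h : D ⊆ D') : cluster G A D ⊆ cluster G A D' :=
  cluster_subset_of_closed (fun _ hA hD => mem_cluster_of_mem hA (h hD))
    fun _ hi _ hij hj => mem_cluster_of_adj hi hij (h hj)

lemma cluster_cluster : cluster G A (cluster G A D) = cluster G A D :=
  cluster_subset.antisymm <| by
    -- The intersection strengthens the induction: extending a path in the inner cluster requires
    -- knowing that the new site lies in `cluster G A D`.
    suffices h : cluster G A D ⊆ cluster G A D ∩ cluster G A (cluster G A D) from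
      h.trans Set.inter_subset_right
    refine cluster_subset_of_closed (fun i hA hD => ?_) fun i hi j hij hj => ?_
    · have := mem_cluster_of_mem (G := G) hA hD
      exact ⟨this, mem_cluster_of_mem hA this⟩
    · have := mem_cluster_of_adj hi.1 hij hj
      exact ⟨this, mem_cluster_of_adj hi.2 hij this⟩

variable [G.LocallyFinite]

/-- Locality: having cluster `γ` is decided by `D` on the neighbourhood of `γ` and on `A`. The
latter is needed because a site of `A ∩ D` away from `γ` would start a further component. -/
lemma cluster_eq_iff {γ : Finset V} :
    cluster G A D = γ ↔
      cluster G A (γ : Set V) = γ ∧ ∀ i ∈ nbhd G γ ∪ A, i ∈ D ↔ i ∈ γ := by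
  constructor
  · intro h
    refine ⟨by rw [← h, cluster_cluster], fun i hi => ⟨fun hD => ?_, fun hγ => ?_⟩⟩
    · rw [← Finset.mem_coe, ← h]
      rcases Finset.mem_union.1 hi with hi | hi
      · rcases Finset.mem_union.1 hi with hi | hi
        · rwa [h]
        · obtain ⟨j, hj, hij⟩ := Finset.mem_biUnion.1 hi
          rw [SimpleGraph.mem_neighborFinset] at hij
          exact mem_cluster_of_adj (by rwa [h]) hij hD
      · exact mem_cluster_of_mem hi hD
    · rw [← Finset.mem_coe, ← h] at hγ
      exact cluster_subset hγ
  · rintro ⟨h, hF⟩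
    refine (cluster_subset_of_closed (fun i hA hD => ?_) fun i hi j hij hj => ?_).antisymm ?_
    · exact (hF i (Finset.mem_union_right _ hA)).1 hD
    · exact (hF j (Finset.mem_union_left _ (mem_nbhd_of_adj G hi hij))).1 hj
    · rw [← h]
      refine cluster_mono fun i hi => ?_
      exact (hF i (Finset.mem_union_left _ (subset_nbhd G γ hi))).2 hi

end Cluster

/-! ### Exchanging two independent copies inside the discrepancy cluster -/

section Swap

variable {V : Type*} (G : SimpleGraph V)

/-- The sites at which one of two configurations differs from `ω`. -/
def discrepancy (ω : V → Spin) (p : (V → Spin) × (V → Spin)) : Set V :=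
  {i | p.1 i ≠ ω i ∨ p.2 i ≠ ω i}

/-- The event that the discrepancy cluster of `A` is `γ`. -/
def clusterEvent (A : Finset V) (ω : V → Spin) (γ : Finset V) :
    Set ((V → Spin) × (V → Spin)) :=
  {p | cluster G A (discrepancy ω p) = γ}

/-- The pairs of sets with union `γ`. -/
noncomputable def covers (γ : Finset V) : Finset (Finset V × Finset V) :=
  (γ.powerset ×ˢ γ.powerset).filter fun q => q.1 ∪ q.2 = γ

lemma mem_covers {γ : Finset V} {q : Finset V × Finset V} : q ∈ covers γ ↔ q.1 ∪ q.2 = γ := by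
  simp only [covers, Finset.mem_filter, Finset.mem_product, Finset.mem_powerset,
    and_iff_right_iff_imp]
  rintro rfl
  exact ⟨Finset.subset_union_left, Finset.subset_union_right⟩

lemma covers_swap {γ : Finset V} {q : Finset V × Finset V} (h : q ∈ covers γ) :
    q.swap ∈ covers γ := by
  rw [mem_covers] at h ⊢
  rw [← h, Prod.fst_swap, Prod.snd_swap, Finset.union_comm]

lemma card_covers_le (γ : Finset V) : (covers γ).card ≤ 4 ^ γ.card := by
  refine (Finset.card_filter_le _ _).trans ?_
  rw [Finset.card_product, Finset.card_powerset, ← mul_pow]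
  norm_num

/-- The pairs of configurations that, on `F`, differ from `ω` exactly on the two sets of `q`. -/
def pairCyl (F : Finset V) (ω : V → Spin) (q : Finset V × Finset V) :
    Set ((V → Spin) × (V → Spin)) :=
  cyl F (flipOn q.1 ω) ×ˢ cyl F (flipOn q.2 ω)

lemma measurableSet_pairCyl (F : Finset V) (ω : V → Spin) (q : Finset V × Finset V) :
    MeasurableSet (pairCyl F ω q) :=
  (measurableSet_cyl _ _).prod (measurableSet_cyl _ _)

lemma ne_iff_of_mem_cyl_flipOn {F γ : Finset V} {σ ω : V → Spin} (h : σ ∈ cyl F (flipOn γ ω))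
    {i : V} (hi : i ∈ F) : σ i ≠ ω i ↔ i ∈ γ := by
  rw [h i hi, flipOn_ne_iff]

lemma pairwiseDisjoint_pairCyl {F γ : Finset V} (hF : γ ⊆ F) (ω : V → Spin) :
    (covers γ : Set (Finset V × Finset V)).PairwiseDisjoint (pairCyl F ω) := by
  intro q hq q' hq' hne
  refine Set.disjoint_left.2 fun p hp hp' => hne ?_
  have aux : ∀ {s t : Finset V} {σ : V → Spin}, s ⊆ γ → t ⊆ γ → σ ∈ cyl F (flipOn s ω) →
      σ ∈ cyl F (flipOn t ω) → s = t := by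
    intro s t σ hs ht h1 h2
    ext i
    by_cases hi : i ∈ γ
    · rw [← ne_iff_of_mem_cyl_flipOn h1 (hF hi), ne_iff_of_mem_cyl_flipOn h2 (hF hi)]
    · exact ⟨fun h => absurd (hs h) hi, fun h => absurd (ht h) hi⟩
  have hq := mem_covers.1 hq
  have hq' := mem_covers.1 hq'
  exact Prod.ext
    (aux (hq ▸ Finset.subset_union_left) (hq' ▸ Finset.subset_union_left) hp.1 hp'.1)
    (aux (hq ▸ Finset.subset_union_right) (hq' ▸ Finset.subset_union_right) hp.2 hp'.2)

lemma pairwiseDisjoint_clusterEvent (A : Finset V) (ω : V → Spin) (s : Set (Finset V)) :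
    s.PairwiseDisjoint (clusterEvent G A ω) := by
  intro γ _ γ' _ hne
  refine Set.disjoint_left.2 fun p hp hp' => hne ?_
  exact_mod_cast (hp : cluster G A (discrepancy ω p) = γ).symm.trans hp'

lemma setOf_cluster_subset (A : Finset V) (ω : V → Spin) (Λ : Finset V) :
    {p | cluster G A (discrepancy ω p) ⊆ Λ} = ⋃ γ ∈ Λ.powerset, clusterEvent G A ω γ := by
  ext p
  simp only [Set.mem_ofPred_eq, Set.mem_iUnion, Finset.mem_powerset, exists_prop, clusterEvent]
  constructor
  · intro h
    have hf := Λ.finite_toSet.subset h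
    exact ⟨hf.toFinset, by simpa using h, by simp⟩
  · rintro ⟨γ, hγ, h⟩
    rw [h]
    exact_mod_cast hγ

variable [G.LocallyFinite]

/-- With two spin values, each copy is determined on the window by where it differs from `ω`; by
locality the cluster is `γ` exactly when these two sets cover `γ` and nothing else there. -/
lemma clusterEvent_eq_biUnion {A γ : Finset V} (h : cluster G A (γ : Set V) = γ) (ω : V → Spin) :
    clusterEvent G A ω γ = ⋃ q ∈ covers γ, pairCyl (nbhd G γ ∪ A) ω q := by
  have hγF : γ ⊆ nbhd G γ ∪ A := (subset_nbhd G γ).trans Finset.subset_union_left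
  ext p
  simp only [clusterEvent, Set.mem_ofPred_eq, cluster_eq_iff, h, true_and, Set.mem_iUnion,
    exists_prop, mem_covers]
  constructor
  · intro hp
    refine ⟨(γ.filter fun i => p.1 i ≠ ω i, γ.filter fun i => p.2 i ≠ ω i), ?_, ?_, ?_⟩
    · ext i
      simp only [Finset.mem_union, Finset.mem_filter]
      constructor
      · rintro (h | h) <;> exact h.1
      · intro hi
        exact ((hp i (hγF hi)).2 hi).imp (fun h => ⟨hi, h⟩) fun h => ⟨hi, h⟩
    · intro i hi
      by_cases hne : p.1 i = ω i
      · simp [flipOn, hne]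
      · simp [flipOn, (hp i hi).1 (Or.inl hne), Spin.eq_flip_of_ne hne, Spin.flip_ne]
    · intro i hi
      by_cases hne : p.2 i = ω i
      · simp [flipOn, hne]
      · simp [flipOn, (hp i hi).1 (Or.inr hne), Spin.eq_flip_of_ne hne, Spin.flip_ne]
  · rintro ⟨q, hq, hp1, hp2⟩ i hi
    rw [← hq, Finset.mem_union, ← ne_iff_of_mem_cyl_flipOn hp1 hi,
      ← ne_iff_of_mem_cyl_flipOn hp2 hi]
    rfl

variable {G} in
lemma clusterEvent_eq_empty {A γ : Finset V} (h : cluster G A (γ : Set V) ≠ γ) (ω : V → Spin) :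
    clusterEvent G A ω γ = ∅ :=
  Set.eq_empty_of_forall_notMem fun _ hp => h (cluster_eq_iff.1 hp).1

lemma measurableSet_clusterEvent (A : Finset V) (ω : V → Spin) (γ : Finset V) :
    MeasurableSet (clusterEvent G A ω γ) := by
  by_cases h : cluster G A (γ : Set V) = γ
  · rw [clusterEvent_eq_biUnion G h]
    exact Finset.measurableSet_biUnion _ fun q _ => measurableSet_pairCyl _ _ _
  · rw [clusterEvent_eq_empty h]
    exact MeasurableSet.empty

lemma measurableSet_cluster_subset (A : Finset V) (ω : V → Spin) (Λ : Finset V) :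
    MeasurableSet {p | cluster G A (discrepancy ω p) ⊆ Λ} := by
  rw [setOf_cluster_subset]
  exact Finset.measurableSet_biUnion _ fun _ _ => measurableSet_clusterEvent G A ω _

variable {ν μ : Measure (V → Spin)}

lemma prod_inter_clusterEvent {A γ : Finset V} (h : cluster G A (γ : Set V) = γ) (ω : V → Spin)
    {E : Set ((V → Spin) × (V → Spin))} (hE : MeasurableSet E) :
    ν.prod μ (E ∩ clusterEvent G A ω γ) =
      ∑ q ∈ covers γ, ν.prod μ (E ∩ pairCyl (nbhd G γ ∪ A) ω q) := by
  rw [clusterEvent_eq_biUnion G h, Set.inter_iUnion₂, measure_biUnion_finset]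
  · intro q hq q' hq' hne
    have := pairwiseDisjoint_pairCyl
      ((subset_nbhd G γ).trans (Finset.subset_union_left (s₂ := A))) ω hq hq' hne
    exact this.mono Set.inter_subset_right Set.inter_subset_right
  · exact fun q _ => hE.inter (measurableSet_pairCyl _ _ _)

lemma measure_cyl_inter_cyl {A F : Finset V} (hA : A ⊆ F) (τ η : V → Spin) :
    ν (cyl A τ ∩ cyl F η) = if η ∈ cyl A τ then ν (cyl F η) else 0 := by
  split_ifs with h
  · rw [Set.inter_eq_right.2]
    rw [← cyl_congr h]
    exact cyl_anti hA η
  · rw [Set.eq_empty_of_forall_notMem (s := cyl A τ ∩ cyl F η), measure_empty]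
    rintro σ ⟨h1, h2⟩
    exact h fun i hi => (h2 i (hA hi)).symm.trans (h1 i hi)

variable [IsProbabilityMeasure μ]

lemma prod_clusterEvent {A γ : Finset V} (h : cluster G A (γ : Set V) = γ) (ω : V → Spin) :
    ν.prod μ (clusterEvent G A ω γ) =
      ∑ q ∈ covers γ, ν (cyl (nbhd G γ ∪ A) (flipOn q.1 ω)) *
        μ (cyl (nbhd G γ ∪ A) (flipOn q.2 ω)) := by
  have := prod_inter_clusterEvent (ν := ν) (μ := μ) G h ω MeasurableSet.univ
  simpa only [Set.univ_inter, pairCyl, Measure.prod_prod] using this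

/-- On the event that the discrepancy cluster of `A` is `γ`, the two configurations can be
exchanged inside `γ`. -/
lemma prod_clusterEvent_swap {β : ℝ} {A γ : Finset V} (hν : FlipRatio G β ν γ)
    (hμ : FlipRatio G β μ γ) (ω τ : V → Spin) :
    ν.prod μ (cyl A τ ×ˢ Set.univ ∩ clusterEvent G A ω γ) =
      ν.prod μ (Set.univ ×ˢ cyl A τ ∩ clusterEvent G A ω γ) := by
  by_cases h : cluster G A (γ : Set V) = γ
  swap
  · simp [clusterEvent_eq_empty h]
  have hA := measurableSet_cyl A τ
  rw [prod_inter_clusterEvent G h ω (hA.prod .univ),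
    prod_inter_clusterEvent G h ω (MeasurableSet.univ.prod hA)]
  have hAF : A ⊆ nbhd G γ ∪ A := Finset.subset_union_right
  have hw : ∀ {ρ : Measure (V → Spin)}, FlipRatio G β ρ γ → ∀ s ⊆ γ,
      ρ (cyl (nbhd G γ ∪ A) (flipOn s ω)) =
        flipWeight G β s ω * ρ (cyl (nbhd G γ ∪ A) ω) := fun hρ s hs =>
    hρ s (by exact_mod_cast hs) _ ((nbhd_mono G hs).trans Finset.subset_union_left) ω
  -- By `hw`, each product of cylinder probabilities is `flipWeight` of `q.1` times that of `q.2`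
  -- times a factor independent of `q`, hence symmetric in the two sets.
  refine Finset.sum_nbij' Prod.swap Prod.swap (fun _ => covers_swap) (fun _ => covers_swap)
    (fun _ _ => rfl) (fun _ _ => rfl) fun q hq => ?_
  have hq := mem_covers.1 hq
  have h1 : q.1 ⊆ γ := hq ▸ Finset.subset_union_left
  have h2 : q.2 ⊆ γ := hq ▸ Finset.subset_union_right
  simp only [pairCyl, Set.prod_inter_prod, Set.univ_inter, Measure.prod_prod, Prod.fst_swap,
    Prod.snd_swap, measure_cyl_inter_cyl hAF, hw hν _ h1, hw hμ _ h2, hw hν _ h2, hw hμ _ h1]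
  split_ifs
  · ring
  · simp

variable [IsProbabilityMeasure ν]

/-- Two measures that satisfy the DLR equations inside `Λ` differ on events in `A` by at most the
probability that the discrepancy cluster of `A` leaves `Λ`. -/
lemma measure_cyl_le_add {β : ℝ} {Λ : Finset V} (hν : FlipRatio G β ν Λ)
    (hμ : FlipRatio G β μ Λ) (A : Finset V) (ω τ : V → Spin) :
    ν (cyl A τ) ≤ μ (cyl A τ) + ν.prod μ {p | ¬ cluster G A (discrepancy ω p) ⊆ Λ} ∧
    μ (cyl A τ) ≤ ν (cyl A τ) + ν.prod μ {p | ¬ cluster G A (discrepancy ω p) ⊆ Λ} := by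
  set E₁ : Set ((V → Spin) × (V → Spin)) := cyl A τ ×ˢ Set.univ with hE₁
  set E₂ : Set ((V → Spin) × (V → Spin)) := Set.univ ×ˢ cyl A τ with hE₂
  have hm₁ : MeasurableSet E₁ := (measurableSet_cyl A τ).prod .univ
  have hm₂ : MeasurableSet E₂ := MeasurableSet.univ.prod (measurableSet_cyl A τ)
  set good := {p | cluster G A (discrepancy ω p) ⊆ Λ} with hgood
  have h₁ : ν.prod μ E₁ = ν (cyl A τ) := by simp [hE₁]
  have h₂ : ν.prod μ E₂ = μ (cyl A τ) := by simp [hE₂]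
  have hE : ∀ E : Set ((V → Spin) × (V → Spin)), MeasurableSet E → ν.prod μ (E ∩ good) =
      ∑ γ ∈ Λ.powerset, ν.prod μ (E ∩ clusterEvent G A ω γ) := by
    intro E hE
    rw [hgood, setOf_cluster_subset, Set.inter_iUnion₂, measure_biUnion_finset]
    · intro γ hγ γ' hγ' hne
      exact (pairwiseDisjoint_clusterEvent G A ω _ hγ hγ' hne).mono Set.inter_subset_right
        Set.inter_subset_right
    · exact fun γ _ => hE.inter (measurableSet_clusterEvent G A ω γ)
  have key : ν.prod μ (E₁ ∩ good) = ν.prod μ (E₂ ∩ good) := by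
    rw [hE _ hm₁, hE _ hm₂]
    refine Finset.sum_congr rfl fun γ hγ => ?_
    have hγ : (γ : Set V) ⊆ Λ := by exact_mod_cast Finset.mem_powerset.1 hγ
    exact prod_clusterEvent_swap G (hν.mono hγ) (hμ.mono hγ) ω τ
  have hle : ∀ E : Set ((V → Spin) × (V → Spin)),
      ν.prod μ E ≤ ν.prod μ (E ∩ good) + ν.prod μ goodᶜ := fun E =>
    (measure_le_inter_add_sdiff _ E good).trans
      (add_le_add le_rfl (measure_mono fun _ h => h.2))
  rw [← h₁, ← h₂]
  exact ⟨(hle E₁).trans (add_le_add (key ▸ measure_mono Set.inter_subset_left) le_rfl),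
    (hle E₂).trans (add_le_add (key ▸ measure_mono Set.inter_subset_left) le_rfl)⟩

end Swap

/-! ### Peierls estimates for the discrepancy cluster -/

section Peierls

variable {V : Type*} (G : SimpleGraph V)

/-- The weight by which the probability that the discrepancy cluster of `A` is `γ` is bounded at
low temperature in a graph whose degrees are at most `d`. -/
noncomputable def clusterWeight (d : ℕ) (A γ : Finset V) : ℝ≥0∞ :=
  if cluster G A (γ : Set V) = γ then ((2 ^ (d + 1))⁻¹) ^ γ.card else 0

/-- The total weight of the clusters of `A` that leave `Λ`. -/
noncomputable def tailWeight (d : ℕ) (A Λ : Finset V) : ℝ≥0∞ :=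
  ∑' γ : Finset V, if γ ⊆ Λ then 0 else clusterWeight G d A γ

variable [G.LocallyFinite]

lemma card_nbhd_le {d : ℕ} (hd : ∀ v, G.degree v ≤ d) (γ : Finset V) :
    (nbhd G γ).card ≤ (d + 1) * γ.card := by
  have h1 : (nbhd G γ).card ≤ γ.card + (γ.biUnion fun v => G.neighborFinset v).card :=
    Finset.card_union_le _ _
  have h2 : (γ.biUnion fun v => G.neighborFinset v).card ≤ γ.card * d :=
    Finset.card_biUnion_le_card_mul _ _ _ fun v _ => by
      simpa using hd v
  linarith

/-- The clusters of `A` in a uniformly chosen subset of a large box have total probability at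
most one. -/
lemma sum_two_pow_card_sdiff_le {A B : Finset V} {t : Finset (Finset V)}
    (ht : ∀ γ ∈ t, cluster G A (γ : Set V) = γ) (hB : ∀ γ ∈ t, nbhd G γ ∪ A ⊆ B) :
    ∑ γ ∈ t, 2 ^ (B \ (nbhd G γ ∪ A)).card ≤ 2 ^ B.card := by
  -- By locality, adding sites off the window leaves the cluster unchanged. So `γ` can be read off
  -- `γ ∪ Y`, and the families for different `γ` are disjoint.
  have hc : ∀ γ ∈ t, ∀ Y ⊆ B \ (nbhd G γ ∪ A), cluster G A ((γ ∪ Y : Finset V) : Set V) = γ := by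
    intro γ hγ Y hY
    refine cluster_eq_iff.2 ⟨ht γ hγ, fun i hi => ?_⟩
    have : i ∉ Y := fun h => (Finset.mem_sdiff.1 (hY h)).2 hi
    simp [this]
  have hcard : ∀ γ ∈ t, ((B \ (nbhd G γ ∪ A)).powerset.image fun Y => γ ∪ Y).card =
      2 ^ (B \ (nbhd G γ ∪ A)).card := by
    intro γ hγ
    rw [Finset.card_image_of_injOn, Finset.card_powerset]
    have hdis : ∀ Y ∈ (B \ (nbhd G γ ∪ A)).powerset, Disjoint γ Y := by
      intro Y hY
      refine Finset.disjoint_left.2 fun i hi hiY => ?_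
      exact (Finset.mem_sdiff.1 (Finset.mem_powerset.1 hY hiY)).2
        (Finset.mem_union_left _ (subset_nbhd G γ hi))
    intro (Y : Finset V) hY (Y' : Finset V) hY' h
    rw [← Finset.union_sdiff_cancel_left (hdis Y hY),
      ← Finset.union_sdiff_cancel_left (hdis Y' hY')]
    exact congrArg (· \ γ) h
  rw [← Finset.sum_congr rfl hcard, ← Finset.card_biUnion, ← Finset.card_powerset]
  · refine Finset.card_le_card fun X hX => ?_
    simp only [Finset.mem_biUnion, Finset.mem_image, Finset.mem_powerset] at hX ⊢
    obtain ⟨γ, hγ, Y, hY, rfl⟩ := hX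
    exact Finset.union_subset (((subset_nbhd G γ).trans Finset.subset_union_left).trans (hB γ hγ))
      (hY.trans Finset.sdiff_subset)
  · intro (γ : Finset V) hγ (γ' : Finset V) hγ' hne
    refine Finset.disjoint_left.2 fun X hX hX' => hne ?_
    simp only [Finset.mem_image, Finset.mem_powerset] at hX hX'
    obtain ⟨Y, hY, rfl⟩ := hX
    obtain ⟨Y', hY', h⟩ := hX'
    have := hc γ hγ Y hY
    rw [← h, hc γ' hγ' Y' hY'] at this
    exact_mod_cast this.symm

/-- A uniformly random subset of a large box has cluster `γ` with probability at least
$2^{-(d+1)|\gamma|-|A|}$, which is the weight of `γ` divided by $2^{|A|}$. These events are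
disjoint, so no counting of connected sets is needed. -/
lemma tsum_clusterWeight_le {d : ℕ} (hd : ∀ v, G.degree v ≤ d) (A : Finset V) :
    ∑' γ, clusterWeight G d A γ ≤ 2 ^ A.card := by
  rw [ENNReal.tsum_eq_iSup_sum]
  refine iSup_le fun s => ?_
  set t : Finset (Finset V) := s.filter fun γ : Finset V => cluster G A (γ : Set V) = γ with ht
  set B := t.biUnion fun γ => nbhd G γ ∪ A with hB
  have hBs : ∀ γ ∈ t, nbhd G γ ∪ A ⊆ B := fun γ hγ =>
    Finset.subset_biUnion_of_mem (fun γ => nbhd G γ ∪ A) hγ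
  have hs : ∑ γ ∈ s, clusterWeight G d A γ = ∑ γ ∈ t, ((2 ^ (d + 1))⁻¹ : ℝ≥0∞) ^ γ.card :=
    (Finset.sum_filter _ _).symm
  have hγ : ∀ γ ∈ t, ((2 ^ (d + 1))⁻¹ : ℝ≥0∞) ^ γ.card * 2 ^ B.card ≤
      2 ^ A.card * 2 ^ (B \ (nbhd G γ ∪ A)).card := by
    intro γ hγ
    have h1 : (nbhd G γ ∪ A).card ≤ (d + 1) * γ.card + A.card :=
      (Finset.card_union_le _ _).trans (Nat.add_le_add_right (card_nbhd_le G hd γ) _)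
    have h2 := Finset.card_sdiff_add_card_eq_card (hBs γ hγ)
    calc ((2 ^ (d + 1))⁻¹ : ℝ≥0∞) ^ γ.card * 2 ^ B.card
        ≤ ((2 ^ (d + 1))⁻¹ : ℝ≥0∞) ^ γ.card *
            2 ^ ((d + 1) * γ.card + (A.card + (B \ (nbhd G γ ∪ A)).card)) := by
          gcongr
          · norm_num
          · omega
      _ = 2 ^ A.card * 2 ^ (B \ (nbhd G γ ∪ A)).card := by
          rw [pow_add _ ((d + 1) * γ.card), pow_mul, ← mul_assoc, ← mul_pow,
            ENNReal.inv_mul_cancel (by simp) (by simp), one_pow, one_mul, pow_add]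
  have hfin := sum_two_pow_card_sdiff_le G (A := A) (B := B) (t := t)
    (fun γ hγ => (Finset.mem_filter.1 hγ).2) hBs
  have hfin' : ∑ γ ∈ t, (2 : ℝ≥0∞) ^ (B \ (nbhd G γ ∪ A)).card ≤ 2 ^ B.card := by
    exact_mod_cast hfin
  rw [hs]
  refine (ENNReal.mul_le_mul_iff_left (c := 2 ^ B.card) (by simp) (by simp)).1 ?_
  rw [Finset.sum_mul]
  refine (Finset.sum_le_sum hγ).trans ?_
  rw [← Finset.mul_sum]
  gcongr

lemma tendsto_tailWeight {d : ℕ} (hd : ∀ v, G.degree v ≤ d) (A : Finset V) :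
    Tendsto (tailWeight G d A) atTop (𝓝 0) := by
  have hfin : ∑' γ, clusterWeight G d A γ ≠ ∞ :=
    ((tsum_clusterWeight_le G hd A).trans_lt (by simp)).ne
  refine ENNReal.tendsto_nhds_zero.2 fun ε hε => ?_
  obtain ⟨s, hs⟩ := (ENNReal.tendsto_nhds_zero.1
    (ENNReal.tendsto_tsum_compl_atTop_zero hfin) ε hε).exists
  -- Once `Λ` contains the union of the members of `s`, any set not inside `Λ` is outside `s`.
  refine eventually_atTop.2 ⟨s.sup id, fun Λ hΛ => le_trans ?_ hs⟩
  change _ ≤ ∑' γ : {γ | γ ∉ s}, clusterWeight G d A γ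
  rw [tsum_subtype]
  refine ENNReal.tsum_le_tsum fun γ => ?_
  split_ifs with hγ
  · exact zero_le
  · rw [Set.indicator_of_mem]
    exact fun hs => hγ ((Finset.le_sup (f := id) hs).trans hΛ)

/-- The sum is the number of boundary edges minus twice the frustrated ones. Isoperimetry bounds the
former below; inhomogeneity allows at most `δ` of the latter per site of `γ`. -/
lemma boundarySum_ge {δ : ℕ} {ω : V → Spin} (hω : IsInhomogeneous G δ ω) (γ : Finset V) :
    (isoperimetricConstant G - 2 * δ) * γ.card ≤ boundarySum G γ ω := by
  have h1 : isoperimetricConstant G * γ.card ≤ (edgeBoundary G γ).card := by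
    rcases γ.eq_empty_or_nonempty with rfl | hγ
    · simp
    · have hpos : (0 : ℝ) < γ.card := by exact_mod_cast hγ.card_pos
      rw [← le_div_iff₀ hpos]
      exact ciInf_le (f := fun γ : {γ : Finset V // γ.Nonempty} =>
        ((edgeBoundary G γ.1).card : ℝ) / (γ.1.card : ℝ))
        ⟨0, by rintro _ ⟨γ, rfl⟩; positivity⟩ ⟨γ, hγ⟩
  have h2 : ((edgeBoundary G γ).filter fun p => ω p.1 ≠ ω p.2).card ≤ δ * γ.card := by
    refine Finset.card_le_mul_card_image_of_maps_to (f := Prod.fst) ?_ δ fun i hi => ?_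
    · intro p hp
      exact ((mem_edgeBoundary G).1 (Finset.mem_filter.1 hp).1).1
    · rw [← Nat.cast_le (α := ℕ∞), ← Set.encard_coe_eq_coe_finsetCard]
      refine le_trans ?_ (hω i)
      refine Set.encard_le_encard_of_injOn (f := Prod.snd) ?_ ?_
      · rintro ⟨a, b⟩ hp
        simp only [Finset.coe_filter, Finset.mem_filter, mem_edgeBoundary,
          Set.mem_ofPred_eq] at hp
        obtain ⟨⟨⟨-, h, -⟩, hne⟩, rfl⟩ := hp
        exact ⟨h, hne⟩
      · rintro ⟨a, b⟩ hp ⟨a', b'⟩ hp' h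
        simp only [Finset.coe_filter, Finset.mem_filter, Set.mem_ofPred_eq] at hp hp'
        exact Prod.ext (hp.2.trans hp'.2.symm) h
  have h3 : boundarySum G γ ω = (edgeBoundary G γ).card -
      2 * ((edgeBoundary G γ).filter fun p => ω p.1 ≠ ω p.2).card := by
    rw [Finset.card_filter, Finset.card_eq_sum_ones]
    push_cast
    rw [Finset.mul_sum, ← Finset.sum_sub_distrib]
    refine Finset.sum_congr rfl fun p _ => ?_
    by_cases h : ω p.1 = ω p.2
    · rw [spinVal_mul_of_eq h, if_neg (not_not.2 h)]
      norm_num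
    · simp [spinVal_mul_of_ne h, h]
      norm_num
  have h2' : (((edgeBoundary G γ).filter fun p => ω p.1 ≠ ω p.2).card : ℝ) ≤ δ * γ.card := by
    exact_mod_cast h2
  rw [h3]
  linarith

/-- The activity of every set of sites is exponentially small in its size. -/
structure ActivityBound (β : ℝ) (d : ℕ) (ω : V → Spin) (x : ℝ≥0∞) : Prop where
  degree_le : ∀ v, G.degree v ≤ d
  flipWeight_le : ∀ γ, flipWeight G β γ ω ≤ x ^ γ.card
  le : 4 * x ≤ (2 ^ (d + 1))⁻¹

variable {G} {β : ℝ} {d : ℕ} {ω : V → Spin} {x : ℝ≥0∞}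

lemma ActivityBound.le_one (h : ActivityBound G β d ω x) : x ≤ 1 := by
  calc x = 1 * x := (one_mul x).symm
    _ ≤ 4 * x := by gcongr; norm_num
    _ ≤ (2 ^ (d + 1))⁻¹ := h.le
    _ ≤ 1 := ENNReal.inv_le_one.2 (one_le_pow₀ (by norm_num))

/-- If `s ⊆ Λ`, compare with the unflipped cylinder, of probability at most one. Otherwise the event
contradicts the boundary condition. -/
lemma finiteVolumeMeasure_cyl_flipOn_le (h : ActivityBound G β d ω x) (Λ : Finset V)
    {s F : Finset V} (hF : nbhd G s ⊆ F) :
    finiteVolumeMeasure G β Λ ω (cyl F (flipOn s ω)) ≤ x ^ s.card := by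
  by_cases hs : s ⊆ Λ
  · rw [flipRatio_finiteVolumeMeasure G β Λ ω s (by exact_mod_cast hs) F hF ω]
    exact (mul_le_of_le_one_right' prob_le_one).trans (h.flipWeight_le s)
  · obtain ⟨i, hi, hiΛ⟩ := Finset.not_subset.1 hs
    have hiF : ({i} : Finset V) ⊆ F :=
      Finset.singleton_subset_iff.2 (hF (subset_nbhd G s hi))
    refine (measure_mono (cyl_anti hiF _)).trans ?_
    rw [finiteVolumeMeasure_cyl_of_disjoint G β (Finset.disjoint_singleton_left.2 hiΛ),
      Set.indicator_of_notMem]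
    · exact zero_le
    · intro h'
      exact flipOn_ne_iff.2 hi (h' i (by simp)).symm

/-- Each pair covering `γ` contributes at most `x ^ γ.card`, as its sizes add up to at least
`γ.card` and `x ≤ 1`. There are at most `4 ^ γ.card` pairs, whence the 4 in `ActivityBound`. -/
lemma prod_clusterEvent_le (h : ActivityBound G β d ω x) (Λ Δ A γ : Finset V) :
    (finiteVolumeMeasure G β Λ ω).prod (finiteVolumeMeasure G β Δ ω) (clusterEvent G A ω γ) ≤
      clusterWeight G d A γ := by
  by_cases hγ : cluster G A (γ : Set V) = γ
  swap
  · simp [clusterEvent_eq_empty hγ]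
  rw [prod_clusterEvent G hγ, clusterWeight, if_pos hγ]
  have hq : ∀ q ∈ covers γ,
      finiteVolumeMeasure G β Λ ω (cyl (nbhd G γ ∪ A) (flipOn q.1 ω)) *
        finiteVolumeMeasure G β Δ ω (cyl (nbhd G γ ∪ A) (flipOn q.2 ω)) ≤ x ^ γ.card := by
    intro q hq
    have hq := mem_covers.1 hq
    have h1 : q.1 ⊆ γ := hq ▸ Finset.subset_union_left
    have h2 : q.2 ⊆ γ := hq ▸ Finset.subset_union_right
    refine (mul_le_mul' (finiteVolumeMeasure_cyl_flipOn_le h Λ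
      ((nbhd_mono G h1).trans Finset.subset_union_left))
      (finiteVolumeMeasure_cyl_flipOn_le h Δ
      ((nbhd_mono G h2).trans Finset.subset_union_left))).trans ?_
    rw [← pow_add]
    exact pow_le_pow_right_of_le_one' h.le_one (hq ▸ Finset.card_union_le _ _)
  calc _ ≤ (covers γ).card • x ^ γ.card := Finset.sum_le_card_nsmul _ _ _ hq
    _ ≤ 4 ^ γ.card * x ^ γ.card := by
        rw [nsmul_eq_mul]
        gcongr
        exact_mod_cast card_covers_le γ
    _ = (4 * x) ^ γ.card := (mul_pow _ _ _).symm
    _ ≤ _ := by gcongr; exact h.le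

variable [Countable V]

lemma ae_eq_off (β : ℝ) (Λ : Finset V) (ω : V → Spin) :
    ∀ᵐ σ ∂finiteVolumeMeasure G β Λ ω, ∀ i ∉ Λ, σ i = ω i := by
  refine ae_all_iff.2 fun i => ?_
  by_cases hi : i ∈ Λ
  · simp [hi]
  have h1 : finiteVolumeMeasure G β Λ ω (cyl {i} ω) = 1 := by
    rw [finiteVolumeMeasure_cyl_of_disjoint G β (Finset.disjoint_singleton_left.2 hi),
      Set.indicator_of_mem (mem_cyl.2 fun _ _ => rfl), Pi.one_apply]
  have h2 := (mem_ae_iff_prob_eq_one (measurableSet_cyl _ _)).2 h1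
  filter_upwards [h2] with σ hσ _ using hσ i (by simp)

/-- Both copies almost surely equal `ω` off `Λ ∪ Δ`, so the cluster is finite and a union bound over
its values applies. The bound does not depend on `Λ` or `Δ`. -/
lemma prod_not_cluster_subset_le (h : ActivityBound G β d ω x) (Λ Δ A Λ₀ : Finset V) :
    (finiteVolumeMeasure G β Λ ω).prod (finiteVolumeMeasure G β Δ ω)
      {p | ¬ cluster G A (discrepancy ω p) ⊆ Λ₀} ≤ tailWeight G d A Λ₀ := by
  set P := (finiteVolumeMeasure G β Λ ω).prod (finiteVolumeMeasure G β Δ ω)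
  have hfin : ∀ᵐ p ∂P, (discrepancy ω p).Finite := by
    filter_upwards [Measure.quasiMeasurePreserving_fst.ae (ae_eq_off (G := G) β Λ ω),
      Measure.quasiMeasurePreserving_snd.ae (ae_eq_off (G := G) β Δ ω)] with p h1 h2
    refine (Λ ∪ Δ).finite_toSet.subset fun i hi => ?_
    by_contra hn
    simp only [Finset.coe_union, Set.mem_union, Finset.mem_coe, not_or] at hn
    exact hi.elim (fun h => h (h1 i hn.1)) fun h => h (h2 i hn.2)
  calc P {p | ¬ cluster G A (discrepancy ω p) ⊆ Λ₀}
      ≤ P (⋃ γ : Finset V, if γ ⊆ Λ₀ then ∅ else clusterEvent G A ω γ) := by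
        refine measure_mono_ae ?_
        filter_upwards [hfin] with p hp hn
        have hc : (cluster G A (discrepancy ω p)).Finite := hp.subset cluster_subset
        refine Set.mem_iUnion.2 ⟨hc.toFinset, ?_⟩
        rw [if_neg]
        · exact hc.coe_toFinset.symm
        · intro hs
          refine hn ?_
          rw [← hc.coe_toFinset]
          exact_mod_cast hs
    _ ≤ ∑' γ : Finset V, P (if γ ⊆ Λ₀ then ∅ else clusterEvent G A ω γ) := measure_iUnion_le _
    _ ≤ _ := by
        refine ENNReal.tsum_le_tsum fun γ => ?_
        split_ifs
        · simp
        · exact prod_clusterEvent_le h Λ Δ A γ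

end Peierls

/-! ### The infinite-volume limit and its extremality -/

section Limit

variable {V : Type*} {G : SimpleGraph V} [G.LocallyFinite] {β : ℝ} {d : ℕ} {ω : V → Spin}
  {x : ℝ≥0∞}

lemma tailWeight_ne_top (hd : ∀ v, G.degree v ≤ d) (A Λ : Finset V) :
    tailWeight G d A Λ ≠ ∞ := by
  refine ((ENNReal.tsum_le_tsum fun γ => ?_).trans_lt
    ((tsum_clusterWeight_le G hd A).trans_lt (by simp))).ne
  split_ifs
  · exact zero_le
  · exact le_rfl

/-- Flip ratios on finite sets pass to limits along cylinder events. -/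
lemma flipRatio_of_tendsto {μ : Measure (V → Spin)}
    (h : ∀ F τ, Tendsto (fun Λ => finiteVolumeMeasure G β Λ ω (cyl F τ)) atTop (𝓝 (μ (cyl F τ)))) :
    FlipRatio G β μ Set.univ := by
  intro γ _ F hF τ
  refine tendsto_nhds_unique (h F (flipOn γ τ)) ?_
  refine (ENNReal.Tendsto.const_mul (h F τ) (Or.inr (flipWeight_ne_top G β γ τ))).congr' ?_
  filter_upwards [eventually_ge_atTop γ] with Λ hΛ
  exact (flipRatio_finiteVolumeMeasure G β Λ ω γ (by exact_mod_cast hΛ) F hF τ).symm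

lemma prod_cluster_subset {ν μ : Measure (V → Spin)} [IsProbabilityMeasure μ]
    (A : Finset V) (ω : V → Spin) (Λ₀ : Finset V) :
    ν.prod μ {p | cluster G A (discrepancy ω p) ⊆ Λ₀} =
      ∑ γ ∈ Λ₀.powerset with cluster G A ((γ : Finset V) : Set V) = γ, ∑ q ∈ covers γ,
        ν (cyl (nbhd G γ ∪ A) (flipOn q.1 ω)) * μ (cyl (nbhd G γ ∪ A) (flipOn q.2 ω)) := by
  rw [setOf_cluster_subset, measure_biUnion_finset (pairwiseDisjoint_clusterEvent G A ω _)
    fun γ _ => measurableSet_clusterEvent G A ω γ, Finset.sum_filter]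
  refine Finset.sum_congr rfl fun γ _ => ?_
  split_ifs with h
  · exact prod_clusterEvent G h ω
  · rw [clusterEvent_eq_empty h, measure_empty]

variable [Countable V]

/-- The complementary event is a finite combination of products of cylinder probabilities, so its
probability passes to the limit. -/
lemma prod_not_cluster_subset_le_of_tendsto (hx : ActivityBound G β d ω x)
    {μ : Measure (V → Spin)} [IsProbabilityMeasure μ]
    (h : ∀ F τ, Tendsto (fun Λ => finiteVolumeMeasure G β Λ ω (cyl F τ)) atTop (𝓝 (μ (cyl F τ))))
    (A Λ₀ : Finset V) :
    μ.prod μ {p | ¬ cluster G A (discrepancy ω p) ⊆ Λ₀} ≤ tailWeight G d A Λ₀ := by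
  have hlim : Tendsto (fun Λ => (finiteVolumeMeasure G β Λ ω).prod (finiteVolumeMeasure G β Λ ω)
      {p | cluster G A (discrepancy ω p) ⊆ Λ₀}) atTop
      (𝓝 (μ.prod μ {p | cluster G A (discrepancy ω p) ⊆ Λ₀})) := by
    simp_rw [prod_cluster_subset]
    refine tendsto_finsetSum _ fun γ _ => tendsto_finsetSum _ fun q _ => ?_
    exact ENNReal.Tendsto.mul (h _ _) (Or.inr (measure_ne_top _ _)) (h _ _)
      (Or.inr (measure_ne_top _ _))
  have hm := measurableSet_cluster_subset G A ω Λ₀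
  have hge : 1 - tailWeight G d A Λ₀ ≤ μ.prod μ {p | cluster G A (discrepancy ω p) ⊆ Λ₀} := by
    refine ge_of_tendsto' hlim fun Λ => ?_
    have h1 := prod_not_cluster_subset_le hx Λ Λ A Λ₀
    rw [← compl_compl {p | cluster G A (discrepancy ω p) ⊆ Λ₀}, prob_compl_eq_one_sub hm.compl]
    exact tsub_le_tsub_left h1 _
  have hc := prob_compl_eq_one_sub (μ := μ.prod μ) hm
  rw [show {p | ¬ cluster G A (discrepancy ω p) ⊆ Λ₀} =
    {p | cluster G A (discrepancy ω p) ⊆ Λ₀}ᶜ from rfl, hc]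
  exact (tsub_le_tsub_left hge _).trans tsub_tsub_le

/-- A Gibbs measure that is absolutely continuous with respect to the limit measure is equal
to it. -/
lemma eq_of_absolutelyContinuous (hx : ActivityBound G β d ω x)
    {μ ν : Measure (V → Spin)} [IsProbabilityMeasure μ] [IsProbabilityMeasure ν]
    (h : ∀ F τ, Tendsto (fun Λ => finiteVolumeMeasure G β Λ ω (cyl F τ)) atTop (𝓝 (μ (cyl F τ))))
    (hν : FlipRatio G β ν Set.univ) (hac : ν ≪ μ) : ν = μ := by
  have hμ : FlipRatio G β μ Set.univ := flipRatio_of_tendsto h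
  refine ext_of_cyl ∅ fun A _ τ => ?_
  set bad : Finset V → Set ((V → Spin) × (V → Spin)) :=
    fun Λ => {p | ¬ cluster G A (discrepancy ω p) ⊆ Λ} with hbad
  have hμ0 : μ.prod μ (⋂ Λ, bad Λ) = 0 := by
    refine le_antisymm (ge_of_tendsto' (tendsto_tailWeight G hx.degree_le A) fun Λ => ?_) zero_le
    exact (measure_mono (Set.iInter_subset _ Λ)).trans
      (prod_not_cluster_subset_le_of_tendsto hx h A Λ)
  -- The only use of absolute continuity: no quantitative bound under `ν` is available, but the null
  -- event of an infinite cluster stays null.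
  have hν0 : ν.prod μ (⋂ Λ, bad Λ) = 0 :=
    (hac.prod (Measure.AbsolutelyContinuous.refl μ)) hμ0
  have htend : Tendsto (fun Λ => ν.prod μ (bad Λ)) atTop (𝓝 0) := by
    rw [← hν0]
    refine tendsto_measure_iInter_atTop (fun Λ => ?_) (fun Λ Λ' hΛ p hp hs => ?_)
      ⟨∅, measure_ne_top _ _⟩
    · exact (measurableSet_cluster_subset G A ω Λ).compl.nullMeasurableSet
    · exact hp (hs.trans (by exact_mod_cast hΛ))
  have hle := fun Λ : Finset V => measure_cyl_le_add G (hν.mono (Set.subset_univ (Λ : Set V)))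
    (hμ.mono (Set.subset_univ _)) A ω τ
  refine le_antisymm ?_ ?_
  · refine ge_of_tendsto' (x := atTop) (f := fun Λ => μ (cyl A τ) + ν.prod μ (bad Λ)) ?_ fun Λ => (hle Λ).1
    simpa using htend.const_add (μ (cyl A τ))
  · refine ge_of_tendsto' (x := atTop) (f := fun Λ => ν (cyl A τ) + ν.prod μ (bad Λ)) ?_ fun Λ => (hle Λ).2
    simpa using htend.const_add (ν (cyl A τ))

/-- The probabilities of cylinder events converge. -/
lemma exists_tendsto_cyl (hx : ActivityBound G β d ω x) (A : Finset V) (τ : V → Spin) :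
    ∃ l, Tendsto (fun Λ => (finiteVolumeMeasure G β Λ ω).real (cyl A τ)) atTop (𝓝 l) := by
  have htop := tailWeight_ne_top hx.degree_le A
  refine cauchySeq_tendsto_of_complete
    (cauchySeq_of_le_tendsto_0 (fun Λ => (tailWeight G d A Λ).toReal) ?_ ?_)
  · have key : ∀ {a b t : ℝ≥0∞}, b ≠ ∞ → t ≠ ∞ → a ≤ b + t → a.toReal ≤ b.toReal + t.toReal := by
      intro a b t hb ht h
      rw [← ENNReal.toReal_add hb ht]
      exact ENNReal.toReal_mono (by simp [hb, ht]) h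
    -- Both volumes contain `N`, so both measures satisfy the flip ratios in `N`, and the tail
    -- beyond `N` bounds their distance.
    intro Λ Δ N hΛ hΔ
    have hle := measure_cyl_le_add G
      ((flipRatio_finiteVolumeMeasure G β Λ ω).mono (U' := N) (by exact_mod_cast hΛ))
      ((flipRatio_finiteVolumeMeasure G β Δ ω).mono (U' := N) (by exact_mod_cast hΔ)) A ω τ
    have ht := prod_not_cluster_subset_le hx Λ Δ A N
    have h1 := key (measure_ne_top _ _) (htop N) (hle.1.trans (add_le_add le_rfl ht))
    have h2 := key (measure_ne_top _ _) (htop N) (hle.2.trans (add_le_add le_rfl ht))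
    rw [Real.dist_eq, abs_le]
    constructor <;> simp only [measureReal_def] <;> linarith
  · exact (ENNReal.tendsto_toReal (by simp)).comp (tendsto_tailWeight G hx.degree_le A)

/-- The finite-volume measure as a probability measure. -/
noncomputable def finiteVolumeProbability (G : SimpleGraph V) [G.LocallyFinite] (β : ℝ)
    (ω : V → Spin) (Λ : Finset V) : ProbabilityMeasure (V → Spin) :=
  ⟨finiteVolumeMeasure G β Λ ω, inferInstance⟩

lemma isWeakLimit_iff {μ : ProbabilityMeasure (V → Spin)} :
    IsWeakLimit G β ω (μ : Measure (V → Spin)) ↔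
      Tendsto (finiteVolumeProbability G β ω) atTop (𝓝 μ) := by
  rw [ProbabilityMeasure.tendsto_iff_forall_integral_tendsto]
  exact ⟨fun h => h.2, fun h => ⟨μ.2, h⟩⟩

/-- Cylinders are clopen, so their probabilities converge along an ultrafilter realising the cluster
point, necessarily to the limit from `exists_tendsto_cyl`. -/
lemma eq_of_mapClusterPt (hx : ActivityBound G β d ω x) {μ μ' : ProbabilityMeasure (V → Spin)}
    (h : MapClusterPt μ atTop (finiteVolumeProbability G β ω))
    (h' : MapClusterPt μ' atTop (finiteVolumeProbability G β ω)) : μ = μ' := by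
  refine ProbabilityMeasure.toMeasure_injective (ext_of_cyl ∅ fun A _ τ => ?_)
  obtain ⟨l, hl⟩ := exists_tendsto_cyl hx A τ
  have key : ∀ {ρ : ProbabilityMeasure (V → Spin)},
      MapClusterPt ρ atTop (finiteVolumeProbability G β ω) →
      (ρ : Measure (V → Spin)).real (cyl A τ) = l := by
    intro ρ hρ
    obtain ⟨U, hU, hUρ⟩ := mapClusterPt_iff_ultrafilter.1 hρ
    have h1 := ProbabilityMeasure.tendsto_measure_of_isClopen_of_tendsto hUρ (isClopen_cyl A τ)
    have h2 := (NNReal.continuous_coe.tendsto _).comp h1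
    exact tendsto_nhds_unique h2 (hl.mono_left hU)
  exact (measureReal_eq_measureReal_iff).1 ((key h).trans (key h').symm)

lemma exists_tendsto_finiteVolumeProbability (hx : ActivityBound G β d ω x) :
    ∃ μ, Tendsto (finiteVolumeProbability G β ω) atTop (𝓝 μ) := by
  have : CompactSpace (V → Spin) := inferInstance
  obtain ⟨μ, hμ⟩ := exists_clusterPt_of_compactSpace
    (map (finiteVolumeProbability G β ω) atTop)
  exact ⟨μ, tendsto_nhds_of_unique_mapClusterPt fun μ' hμ' => eq_of_mapClusterPt hx hμ' hμ⟩

lemma exists_weakLimit_extreme (hx : ActivityBound G β d ω x) :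
    ∃ μ : Measure (V → Spin), IsWeakLimit G β ω μ ∧ (∀ ν, IsWeakLimit G β ω ν → ν = μ) ∧
      μ ∈ gibbsMeasures G β ∧ μ ∈ Set.extremePoints ℝ≥0 (gibbsMeasures G β) := by
  obtain ⟨μ, hμ⟩ := exists_tendsto_finiteVolumeProbability hx
  have hcyl : ∀ F τ, Tendsto (fun Λ => finiteVolumeMeasure G β Λ ω (cyl F τ)) atTop
      (𝓝 ((μ : Measure (V → Spin)) (cyl F τ))) := fun F τ =>
    ProbabilityMeasure.tendsto_measure_of_null_frontier_of_tendsto' hμ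
      (by simp [(isClopen_cyl F τ).frontier_eq])
  have hG : (μ : Measure (V → Spin)) ∈ gibbsMeasures G β :=
    mem_gibbsMeasures_of_flipRatio G (flipRatio_of_tendsto hcyl)
  refine ⟨μ, isWeakLimit_iff.2 hμ, fun ν hν => ?_, hG, ?_⟩
  · have := hν.1
    have hν' := (isWeakLimit_iff (μ := ⟨ν, this⟩)).1 hν
    exact congrArg ProbabilityMeasure.toMeasure (tendsto_nhds_unique hν' hμ)
  · refine mem_extremePoints_iff_left.2 ⟨hG, fun ν hν ν' _ hs => ?_⟩
    obtain ⟨a, b, ha, hb, -, hab⟩ := hs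
    -- Here `μ = a • ν + b • ν'` with `a > 0`, so `μ`-null sets are `ν`-null.
    have := hν.1
    refine eq_of_absolutelyContinuous hx hcyl (flipRatio_of_mem_gibbsMeasures hν) ?_
    refine Measure.AbsolutelyContinuous.mk fun s _ hs => ?_
    rw [← hab, Measure.add_apply, add_eq_zero, Measure.smul_apply] at hs
    simpa [ha.ne', ENNReal.smul_def] using hs.1

end Limit

/-! ### Countability and constant degree -/

section Graph

variable {V : Type*} {G : SimpleGraph V}

lemma countable_of_connected [G.LocallyFinite] (h : G.Connected) : Countable V := by
  obtain ⟨v⟩ := h.nonempty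
  have hc : (⋃ n, (((nbhd G)^[n] {v} : Finset V) : Set V)).Countable :=
    Set.countable_iUnion fun n => Finset.countable_toSet _
  refine Set.countable_univ_iff.1 (hc.mono fun w _ => ?_)
  have hw := (SimpleGraph.reachable_iff_reflTransGen v w).1 (h.preconnected v w)
  induction hw with
  | refl => exact Set.mem_iUnion.2 ⟨0, by simp⟩
  | tail _ hbc ih =>
    obtain ⟨n, hn⟩ := Set.mem_iUnion.1 (ih trivial)
    refine Set.mem_iUnion.2 ⟨n + 1, ?_⟩
    rw [Function.iterate_succ_apply']
    exact mem_nbhd_of_adj G hn hbc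

lemma degree_eq_of_isTransitive [G.LocallyFinite] (h : IsTransitive G) (u v : V) :
    G.degree u = G.degree v := by
  obtain ⟨φ, rfl⟩ := h u v
  exact (φ.degree_eq u).symm

end Graph
end Ising

theorem theorem2p1 {V : Type*} (G : SimpleGraph V) [G.LocallyFinite] (hconn : G.Connected)
    (htrans : Ising.IsTransitive G) (δmax : ℕ)
    (hδ : (δmax : ℝ) < Ising.isoperimetricConstant G / 2) :
    ∃ β₀ : ℝ, 0 < β₀ ∧ ∀ β : ℝ, β₀ < β →
      ∀ ω : V → Ising.Spin, Ising.IsInhomogeneous G δmax ω →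
        ∃ μ : MeasureTheory.Measure (V → Ising.Spin),
          Ising.IsWeakLimit G β ω μ ∧ (∀ ν, Ising.IsWeakLimit G β ω ν → ν = μ) ∧
          μ ∈ Ising.gibbsMeasures G β ∧
          μ ∈ Set.extremePoints NNReal (Ising.gibbsMeasures G β) := by
  have := Ising.countable_of_connected hconn
  obtain ⟨v⟩ := hconn.nonempty
  set d := G.degree v
  set c := Ising.isoperimetricConstant G - 2 * δmax with hc
  have hc0 : 0 < c := by rw [hc]; linarith
  have hlog : 0 < Real.log (2 ^ (d + 3)) :=
    Real.log_pos (one_lt_pow₀ (by norm_num) (by omega))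
  -- Chosen so that $e^{-2\beta c}\le 2^{-(d+3)}$, that is, $4x\le 2^{-(d+1)}$ for the activity
  -- $x=e^{-2\beta c}$.
  refine ⟨Real.log (2 ^ (d + 3)) / (2 * c), by positivity, fun β hβ ω hω => ?_⟩
  rw [div_lt_iff₀ (by positivity)] at hβ
  have hβ0 : 0 < β := by
    by_contra h
    nlinarith
  refine Ising.exists_weakLimit_extreme (d := d) (x := ENNReal.ofReal (Real.exp (-2 * β * c)))
    ⟨fun u => (Ising.degree_eq_of_isTransitive htrans u v).le, fun γ => ?_, ?_⟩
  · rw [Ising.flipWeight, ← ENNReal.ofReal_pow (Real.exp_nonneg _), ← Real.exp_nat_mul]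
    refine ENNReal.ofReal_le_ofReal (Real.exp_le_exp.2 ?_)
    nlinarith [Ising.boundarySum_ge G hω γ]
  · have h1 : Real.exp (-2 * β * c) ≤ (2 ^ (d + 3))⁻¹ := by
      rw [← Real.exp_log (x := (2 ^ (d + 3) : ℝ)) (by positivity), ← Real.exp_neg]
      exact Real.exp_le_exp.2 (by linarith)
    have h2 : (2 ^ (d + 1) : ENNReal)⁻¹ = ENNReal.ofReal (2 ^ (d + 1))⁻¹ := by
      rw [ENNReal.ofReal_inv_of_pos (by positivity), ENNReal.ofReal_pow (by norm_num)]
      simp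
    rw [h2, show (4 : ENNReal) = ENNReal.ofReal 4 by simp, ← ENNReal.ofReal_mul (by norm_num)]
    refine ENNReal.ofReal_le_ofReal ?_
    calc 4 * Real.exp (-2 * β * c) ≤ 4 * (2 ^ (d + 3))⁻¹ := by gcongr
      _ = (2 ^ (d + 1))⁻¹ := by
        rw [pow_add, pow_add]
        field_simp
        norm_num
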